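/- Let $\Omega\subset\mathbb R^n$ be a properly convex quasi-homogeneous affine domain; that is, $\Omega$ is open and convex, contains no complete affine line, and there are a subgroup $G$ of the group of affine transformations of $\mathbb R^n$ preserving $\Omega$ and a compact set $K\subset\Omega$ with $GK=\Omega$. Let $$\mathrm{AC}(\Omega)=\{u\in\mathbb R^n : x+tu\in\Omega \text{ for all } x\in\Omega,\ t\ge 0\}$$ be its asymptotic cone (a closed convex cone if $\Omega\neq\varnothing$), let $L$ be the linear span of $\mathrm{AC}(\Omega)$, and for $x\in\Omega$ put $\Omega_x=\Omega\cap(x+L)$. Then $\Omega$ is foliated by translates of its asymptotic cone in the following sense: for every $x\in\Omega$ there is a point $s\in\mathbb R^n$ such that $$\Omega_x=s+\operatorname{relint}\mathrm{AC}(\Omega)\qquad\text{and}\qquad \overline{\Omega_x}=s+\mathrm{AC}(\Omega),$$ where $\operatorname{relint}$ denotes the interior relative to the affine span (which here is $L$). -/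

import Mathlib

/-- The group of all affine transformations of `ℝⁿ` that preserve the set `Ω`. -/
def affineAut {n : ℕ} (Ω : Set (EuclideanSpace ℝ (Fin n))) :
    Subgroup (EuclideanSpace ℝ (Fin n) ≃ᵃ[ℝ] EuclideanSpace ℝ (Fin n)) where
  carrier := {g | g '' Ω = Ω}
  one_mem' := by simp
  mul_mem' := by
    intro g h hg hh
    simp only [Set.mem_setOf_eq, AffineEquiv.coe_mul, Set.image_comp] at *
    rw [hh, hg]
  inv_mem' := by
    intro g hg
    simp only [Set.mem_setOf_eq] at *
    conv_lhs => rw [← hg]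
    rw [← Set.image_comp, ← AffineEquiv.coe_mul, inv_mul_cancel]
    simp

/-- `Ω` is a quasi-homogeneous affine domain: an open subset of `ℝⁿ` with a subgroup `G` of its
affine automorphism group and a compact subset `K` such that `G K = Ω`. -/
def IsQuasiHomogeneous {n : ℕ} (Ω : Set (EuclideanSpace ℝ (Fin n))) : Prop :=
  IsOpen Ω ∧
    ∃ G : Subgroup (EuclideanSpace ℝ (Fin n) ≃ᵃ[ℝ] EuclideanSpace ℝ (Fin n)),
      G ≤ affineAut Ω ∧
      ∃ K : Set (EuclideanSpace ℝ (Fin n)), IsCompact K ∧ K ⊆ Ω ∧ (⋃ g ∈ G, g '' K) = Ω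

/-- `Ω` is properly convex: it is convex and contains no complete affine line. (A non-constant
projective map of `ℝ` into `ℝPⁿ` whose image lies in the affine chart `ℝⁿ` has a complete
affine line as its image.) -/
def IsProperlyConvex {n : ℕ} (Ω : Set (EuclideanSpace ℝ (Fin n))) : Prop :=
  Convex ℝ Ω ∧ ∀ x v : EuclideanSpace ℝ (Fin n), (∀ t : ℝ, x + t • v ∈ Ω) → v = 0

/-- The asymptotic cone `AC(Ω)`. -/
def AC {n : ℕ} (Ω : Set (EuclideanSpace ℝ (Fin n))) : Set (EuclideanSpace ℝ (Fin n)) :=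
  {u | ∀ x ∈ Ω, ∀ t : ℝ, 0 ≤ t → x + t • u ∈ Ω}

/-- The section `Ω_x = Ω ∩ (x + L)`, where `L` is the linear span of `AC(Ω)`. -/
def asymptoticSection {n : ℕ} (Ω : Set (EuclideanSpace ℝ (Fin n)))
    (x : EuclideanSpace ℝ (Fin n)) : Set (EuclideanSpace ℝ (Fin n)) :=
  Ω ∩ (AffineSubspace.mk' x (Submodule.span ℝ (AC Ω)) : Set (EuclideanSpace ℝ (Fin n)))

/-! Let C be the asymptotic cone inside L, and D_x = x - Ω_x, a convex set whose closure contains v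
- C for each of its points v. The size of D ⊆ L is measured by Φ(D) = ∫ exp(-h_D), with h_D the
support function. Φ reverses inclusions, is multiplied by |det A|⁻¹ under a linear automorphism A,
and tells nested convex sets apart up to closure (`subset_closure_of_laplaceVolume_le`). On v - C it
is the characteristic function φ(v) of the cone, convex and homogeneous of degree -dim L.

Let m(x) be the minimum of φ on closure D_x ∩ C. Then m(x)/Φ(D_x) ≥ 1, and equality makes D_x a
translated cone up to closure. The ratio is invariant under automorphisms and upper semicontinuous,
so quasi-homogeneity lets it attain a maximum κ, at some y with minimizer v₀.

Sliding y towards y - v₀ (`expand_mem_closure_of_extremal`) replaces D_y by D_y - (1-t)v₀, whose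
closure contains tD_y. If its Laplace volume were strictly below Φ(tD_y), the bound by κ and the
convexity of φ would produce a better apex than v₀. So the two sets agree up to closure, closure D_y
is stable under expansion about v₀, and therefore lies in v₀ - C. This forces κ ≤ 1, so the ratio is
1 at every x. -/

open MeasureTheory Set Filter Topology
open scoped ENNReal

/-! ### Integrals of exponentials of support functions -/

section LaplaceVolume

variable {V : Type*} [NormedAddCommGroup V] [InnerProductSpace ℝ V]

/-- The exponential `exp (-h_D(ξ))` of minus the support function of `D`. -/
noncomputable def laplaceWeight (D : Set V) (ξ : V) : ℝ≥0∞ :=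
  ⨅ v ∈ D, ENNReal.ofReal (Real.exp (-inner ℝ ξ v))

theorem laplaceWeight_le {D : Set V} {v : V} (hv : v ∈ D) (ξ : V) :
    laplaceWeight D ξ ≤ ENNReal.ofReal (Real.exp (-inner ℝ ξ v)) :=
  iInf₂_le v hv

theorem laplaceWeight_anti {D D' : Set V} (h : D ⊆ D') (ξ : V) :
    laplaceWeight D' ξ ≤ laplaceWeight D ξ :=
  biInf_mono fun _ hv => h hv

theorem le_laplaceWeight {D : Set V} {ξ : V} {M : ℝ} (h : ∀ v ∈ D, inner ℝ ξ v ≤ M) :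
    ENNReal.ofReal (Real.exp (-M)) ≤ laplaceWeight D ξ :=
  le_iInf₂ fun v hv =>
    ENNReal.ofReal_le_ofReal (Real.exp_le_exp.2 (neg_le_neg (h v hv)))

theorem laplaceWeight_closure (D : Set V) (ξ : V) :
    laplaceWeight (closure D) ξ = laplaceWeight D ξ := by
  refine le_antisymm (laplaceWeight_anti subset_closure ξ) (le_iInf₂ fun v hv => ?_)
  have hcl : IsClosed {v : V | laplaceWeight D ξ ≤ ENNReal.ofReal (Real.exp (-inner ℝ ξ v))} :=
    isClosed_le continuous_const (ENNReal.continuous_ofReal.comp (by fun_prop))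
  exact closure_minimal (fun w hw => laplaceWeight_le hw ξ) hcl hv

theorem measurable_laplaceWeight [MeasurableSpace V] [BorelSpace V] (D : Set V) :
    Measurable (laplaceWeight D) := by
  refine UpperSemicontinuous.measurable ?_
  refine upperSemicontinuous_biInf fun v _ => Continuous.upperSemicontinuous ?_
  exact ENNReal.continuous_ofReal.comp (by fun_prop)

/-- `D` lies in a translate of a convex cone on which a linear functional grows at least like
the norm. -/
def CoercivelyBounded (D : Set V) : Prop :=
  ∃ (η : V) (r M : ℝ), 0 < r ∧ ∀ v ∈ D, inner ℝ η v + r * ‖v‖ ≤ M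

theorem CoercivelyBounded.image_smul {D : Set V} (hD : CoercivelyBounded D) {t : ℝ} (ht : 0 < t) :
    CoercivelyBounded ((fun v => t • v) '' D) := by
  obtain ⟨η, r, M, hr, h⟩ := hD
  refine ⟨η, r, t * M, hr, ?_⟩
  rintro _ ⟨v, hv, rfl⟩
  rw [inner_smul_right, norm_smul, Real.norm_of_nonneg ht.le]
  have := mul_le_mul_of_nonneg_left (h v hv) ht.le
  linarith

theorem CoercivelyBounded.mono {D D' : Set V} (h : D ⊆ D') (hD : CoercivelyBounded D') :
    CoercivelyBounded D := by
  obtain ⟨η, r, M, hr, hM⟩ := hD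
  exact ⟨η, r, M, hr, fun v hv => hM v (h hv)⟩

theorem CoercivelyBounded.closure {D : Set V} (hD : CoercivelyBounded D) :
    CoercivelyBounded (closure D) := by
  obtain ⟨η, r, M, hr, hM⟩ := hD
  exact ⟨η, r, M, hr, fun v hv => closure_minimal hM
    (isClosed_le (f := fun v => inner ℝ η v + r * ‖v‖) (by fun_prop) continuous_const) hv⟩

theorem inner_add_le_of_coercive {v η ζ : V} {r M : ℝ} (h : inner ℝ η v + r * ‖v‖ ≤ M)
    (hζ : ‖ζ‖ ≤ r) : inner ℝ (η + ζ) v ≤ M := by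
  rw [inner_add_left]
  have h1 : inner ℝ ζ v ≤ ‖ζ‖ * ‖v‖ := real_inner_le_norm ζ v
  have h2 : ‖ζ‖ * ‖v‖ ≤ r * ‖v‖ := mul_le_mul_of_nonneg_right hζ (norm_nonneg v)
  linarith

variable [MeasurableSpace V] (μ : Measure V)

/-- The integral over `ξ` of `exp (-h_D(ξ))`, where `h_D` is the support function of `D`. -/
noncomputable def laplaceVolume (D : Set V) : ℝ≥0∞ := ∫⁻ ξ, laplaceWeight D ξ ∂μ

theorem laplaceVolume_anti {D D' : Set V} (h : D ⊆ D') :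
    laplaceVolume μ D' ≤ laplaceVolume μ D :=
  lintegral_mono fun ξ => laplaceWeight_anti h ξ

theorem laplaceVolume_closure (D : Set V) : laplaceVolume μ (closure D) = laplaceVolume μ D := by
  simp only [laplaceVolume, laplaceWeight_closure]

variable [BorelSpace V] [μ.IsAddHaarMeasure]

/-- Coercivity bounds the support function by `M` on the ball of radius `r` about `η`, so the weight
is at least exp(-M) there, whereas a zero integral would make it vanish on a dense set. -/
theorem laplaceVolume_pos {D : Set V} (hD : CoercivelyBounded D) : laplaceVolume μ D ≠ 0 := by
  obtain ⟨η, r, M, hr, h⟩ := hD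
  intro h0
  rw [laplaceVolume, lintegral_eq_zero_iff (measurable_laplaceWeight D)] at h0
  obtain ⟨ξ, hξ, hξ'⟩ := (Measure.dense_of_ae h0).exists_dist_lt η hr
  have h2 : ENNReal.ofReal (Real.exp (-M)) ≤ laplaceWeight D ξ := by
    refine le_laplaceWeight fun v hv => ?_
    have := inner_add_le_of_coercive (h v hv) (ζ := ξ - η) (by
      rw [← dist_eq_norm, dist_comm]; exact hξ'.le)
    simpa using this
  have h3 : laplaceWeight D ξ = 0 := hξ
  rw [h3] at h2
  have := ENNReal.ofReal_eq_zero.1 (le_antisymm h2 bot_le)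
  exact absurd this (not_le.2 (Real.exp_pos _))

variable [FiniteDimensional ℝ V]

theorem laplaceVolume_smul {c : ℝ} (hc : 0 < c) (D : Set V) :
    laplaceVolume μ ((fun v => c • v) '' D)
      = ENNReal.ofReal ((c ^ Module.finrank ℝ V)⁻¹) * laplaceVolume μ D := by
  have h1 : ∀ ξ, laplaceWeight ((fun v => c • v) '' D) ξ = laplaceWeight D (c • ξ) := by
    intro ξ
    simp only [laplaceWeight, iInf_image, inner_smul_left, inner_smul_right, RCLike.conj_to_real]
  have h2 := Measure.map_addHaar_smul μ hc.ne'
  simp only [laplaceVolume, h1]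
  rw [← lintegral_map (f := laplaceWeight D) (g := fun ξ : V => c • ξ)
    (measurable_laplaceWeight D) (by fun_prop), h2, lintegral_smul_measure,
    abs_of_pos (by positivity), smul_eq_mul]

/-- The support function of A D is that of D composed with the adjoint of A. The value of `k` is
irrelevant: it cancels when two volumes are compared. -/
theorem exists_laplaceVolume_linearEquiv (A : V ≃ₗ[ℝ] V) :
    ∃ k : ℝ≥0∞, k ≠ 0 ∧ k ≠ ∞ ∧ ∀ D : Set V, laplaceVolume μ (A '' D) = k * laplaceVolume μ D := by
  set B : V →ₗ[ℝ] V := LinearMap.adjoint (A : V →ₗ[ℝ] V) with hB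
  have hdet : LinearMap.det B ≠ 0 := by
    intro h
    have hbot : LinearMap.ker B ≠ ⊥ := (LinearMap.bot_lt_ker_of_det_eq_zero h).ne'
    apply hbot
    rw [LinearMap.ker_eq_bot']
    intro ξ hξ
    have : inner ℝ (B ξ) (A.symm ξ) = inner ℝ ξ ξ := by
      rw [hB, LinearMap.adjoint_inner_left]; simp
    rw [hξ, inner_zero_left] at this
    exact inner_self_eq_zero.1 this.symm
  refine ⟨ENNReal.ofReal |(LinearMap.det B)⁻¹|, ?_, ENNReal.ofReal_ne_top, fun D => ?_⟩
  · simpa using hdet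
  have h1 : ∀ ξ, laplaceWeight (A '' D) ξ = laplaceWeight D (B ξ) := by
    intro ξ
    simp only [laplaceWeight, iInf_image, hB, LinearMap.adjoint_inner_left, LinearEquiv.coe_coe]
  have h2 := Measure.map_linearMap_addHaar_eq_smul_addHaar μ hdet
  simp only [laplaceVolume, h1]
  rw [← lintegral_map (f := laplaceWeight D) (g := fun ξ : V => B ξ)
    (measurable_laplaceWeight D) B.continuous_of_finiteDimensional.measurable, h2,
    lintegral_smul_measure, smul_eq_mul]

theorem lintegral_exp_neg_norm_lt_top {r : ℝ} (hr : 0 < r) :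
    ∫⁻ ξ : V, ENNReal.ofReal (Real.exp (-(r * ‖ξ‖))) ∂μ < ∞ := by
  set m : ℕ := Module.finrank ℝ V + 1 with hm
  set c : ℝ := Real.exp r * m.factorial / r ^ m with hc
  have hfin := finite_integral_one_add_norm (E := V) (μ := μ) (r := (m : ℝ))
    (by rw [hm]; push_cast; linarith)
  refine lt_of_le_of_lt (lintegral_mono (g := fun ξ : V => ENNReal.ofReal c *
    ENNReal.ofReal ((1 + ‖ξ‖) ^ (-(m : ℝ)))) fun ξ => ?_) ?_
  · simp only
    rw [← ENNReal.ofReal_mul (by positivity)]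
    refine ENNReal.ofReal_le_ofReal ?_
    have h1 : (0 : ℝ) < 1 + ‖ξ‖ := by positivity
    have h2 := Real.pow_div_factorial_le_exp (r * (1 + ‖ξ‖)) (by positivity) m
    rw [Real.rpow_neg h1.le, Real.rpow_natCast]
    have h3 : Real.exp (-(r * ‖ξ‖)) = Real.exp r * (Real.exp (r * (1 + ‖ξ‖)))⁻¹ := by
      rw [← Real.exp_neg, ← Real.exp_add]; congr 1; ring
    have h4 : (Real.exp (r * (1 + ‖ξ‖)))⁻¹ ≤ ((r * (1 + ‖ξ‖)) ^ m / m.factorial)⁻¹ :=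
      inv_anti₀ (by positivity) h2
    calc Real.exp (-(r * ‖ξ‖)) ≤ Real.exp r * ((r * (1 + ‖ξ‖)) ^ m / m.factorial)⁻¹ := by
          rw [h3]; exact mul_le_mul_of_nonneg_left h4 (Real.exp_pos r).le
      _ = c * ((1 + ‖ξ‖) ^ m)⁻¹ := by
          rw [hc, mul_pow]; field_simp
  · rw [lintegral_const_mul' _ _ ENNReal.ofReal_ne_top]
    exact ENNReal.mul_lt_top ENNReal.ofReal_lt_top hfin

/-- Testing the point of the ball in direction ξ shows that the support function is at least r‖ξ‖.
-/
theorem laplaceVolume_lt_top {D : Set V} {r : ℝ} (hr : 0 < r)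
    (hD : Metric.closedBall (0 : V) r ⊆ D) : laplaceVolume μ D < ∞ := by
  refine lt_of_le_of_lt (lintegral_mono fun ξ => ?_) (lintegral_exp_neg_norm_lt_top μ hr)
  refine (laplaceWeight_le (v := (r / ‖ξ‖) • ξ) (hD ?_) ξ).trans ?_
  · rw [mem_closedBall_zero_iff, norm_smul, norm_div, norm_norm, Real.norm_of_nonneg hr.le]
    rcases eq_or_ne ‖ξ‖ 0 with h | h
    · simp [h, hr.le]
    · exact (div_mul_cancel₀ r h).le
  · refine ENNReal.ofReal_le_ofReal (Real.exp_le_exp.2 (neg_le_neg ?_))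
    rw [inner_smul_right, real_inner_self_eq_norm_sq]
    rcases eq_or_ne ‖ξ‖ 0 with h | h
    · simp [h]
    · apply le_of_eq; field_simp

/-- Two nested convex sets with the same finite Laplace volume have the same closure. -/
theorem subset_closure_of_laplaceVolume_le {D D' : Set V} (hc : Convex ℝ D) (hD : CoercivelyBounded D)
    (hsub : D ⊆ D') (hfin : laplaceVolume μ D' ≠ ∞)
    (hle : laplaceVolume μ D ≤ laplaceVolume μ D') : D' ⊆ closure D := by
  obtain ⟨η, r, M, hr, h⟩ := hD
  have hae : laplaceWeight D' =ᵐ[μ] laplaceWeight D :=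
    ae_eq_of_ae_le_of_lintegral_le (Eventually.of_forall (laplaceWeight_anti hsub)) hfin
      (measurable_laplaceWeight D).aemeasurable hle
  intro v₀ hv₀
  by_contra hv
  obtain ⟨f, u, hf, hfv⟩ := geometric_hahn_banach_closed_point hc.closure isClosed_closure hv
  set ξ₀ : V := (InnerProductSpace.toDual ℝ V).symm f with hξ₀
  have hinner : ∀ v, inner ℝ ξ₀ v = f v := fun v => InnerProductSpace.toDual_symm_apply
  -- The support function is bounded at `ξ₀` but perhaps not nearby; shifting by `ε • η` gives a
  -- whole ball on which it is at most `u + ε * M`, and this ball contains some ξ where the weights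
  -- agree. `B` is chosen so that all errors of order ε together stay below half the separation gap.
  set B : ℝ := |M| + (‖η‖ + r) * ‖v₀‖ + 1 with hB
  have hBpos : 0 < B := by positivity
  set ε : ℝ := (f v₀ - u) / (2 * B) with hε
  have hεpos : 0 < ε := div_pos (sub_pos.2 hfv) (by positivity)
  have hεB : ε * B = (f v₀ - u) / 2 := by rw [hε]; field_simp
  obtain ⟨ξ, hξ, hξd⟩ := (Measure.dense_of_ae hae).exists_dist_lt (ξ₀ + ε • η)
    (mul_pos hεpos hr)
  have hξ' : laplaceWeight D' ξ = laplaceWeight D ξ := hξ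
  set ζ : V := ε⁻¹ • (ξ - (ξ₀ + ε • η)) with hζ
  have hζr : ‖ζ‖ ≤ r := by
    rw [hζ, norm_smul, norm_inv, Real.norm_of_nonneg hεpos.le, ← dist_eq_norm, dist_comm,
      inv_mul_le_iff₀ hεpos]
    exact hξd.le
  have hξeq : ξ = ξ₀ + ε • (η + ζ) := by
    rw [hζ, smul_add, smul_inv_smul₀ hεpos.ne']; abel
  have h1 : ENNReal.ofReal (Real.exp (-(u + ε * M))) ≤ laplaceWeight D ξ := by
    refine le_laplaceWeight fun v hv => ?_
    rw [hξeq, inner_add_left, inner_smul_left, hinner, RCLike.conj_to_real]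
    have := mul_le_mul_of_nonneg_left (inner_add_le_of_coercive (h v hv) hζr) hεpos.le
    have := hf v (subset_closure hv)
    linarith
  have h2 := laplaceWeight_le hv₀ ξ
  rw [hξ'] at h2
  have h3 := (ENNReal.ofReal_le_ofReal_iff (Real.exp_pos _).le).1 (h1.trans h2)
  rw [Real.exp_le_exp, neg_le_neg_iff, hξeq, inner_add_left, inner_smul_left, hinner,
    RCLike.conj_to_real] at h3
  have h4 : -((‖η‖ + r) * ‖v₀‖) ≤ inner ℝ (η + ζ) v₀ := by
    have h5 := neg_le_of_abs_le (abs_real_inner_le_norm (η + ζ) v₀)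
    have h6 : ‖η + ζ‖ * ‖v₀‖ ≤ (‖η‖ + r) * ‖v₀‖ :=
      mul_le_mul_of_nonneg_right ((norm_add_le _ _).trans (by linarith)) (norm_nonneg _)
    linarith
  have h7 := mul_le_mul_of_nonneg_left h4 hεpos.le
  have h8 : ε * M ≤ ε * |M| := mul_le_mul_of_nonneg_left (le_abs_self M) hεpos.le
  have h9 : ε * B = ε * |M| + ε * ((‖η‖ + r) * ‖v₀‖) + ε := by rw [hB]; ring
  have h10 := hfv
  nlinarith

end LaplaceVolume

/-! ### The characteristic function of a convex cone -/

section ConeLaplace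

variable {V : Type*} [NormedAddCommGroup V] [InnerProductSpace ℝ V]

-- Off the dual cone, following a ray of `C` on which ξ is negative drives the exponent to -∞.
open Classical in
theorem laplaceWeight_sub_cone {C : Set V} (h0 : (0 : V) ∈ C)
    (hs : ∀ c ∈ C, ∀ t : ℝ, 0 ≤ t → t • c ∈ C) (v ξ : V) :
    laplaceWeight ((fun c => v - c) '' C) ξ =
      if ∀ c ∈ C, 0 ≤ inner ℝ ξ c then ENNReal.ofReal (Real.exp (-inner ℝ ξ v)) else 0 := by
  split_ifs with h
  · refine le_antisymm ?_ (le_laplaceWeight ?_)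
    · simpa using laplaceWeight_le (mem_image_of_mem (fun c => v - c) h0) ξ
    rintro _ ⟨c, hc, rfl⟩
    rw [inner_sub_right]
    linarith [h c hc]
  · push Not at h
    obtain ⟨c, hc, hneg⟩ := h
    refine le_antisymm (ge_of_tendsto' (x := (atTop : Filter ℕ)) (f := fun n : ℕ =>
      ENNReal.ofReal (Real.exp (-inner ℝ ξ (v - (n : ℝ) • c)))) ?_
      fun n => laplaceWeight_le
        (mem_image_of_mem (fun c => v - c) (hs c hc n n.cast_nonneg)) ξ) bot_le
    rw [← ENNReal.ofReal_zero]
    refine (ENNReal.continuous_ofReal.tendsto 0).comp (Real.tendsto_exp_atBot.comp ?_)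
    have : ∀ n : ℕ, -inner ℝ ξ (v - (n : ℝ) • c) = inner ℝ ξ c * (n : ℝ) + -inner ℝ ξ v := by
      intro n
      rw [inner_sub_right, inner_smul_right]; ring
    simp only [this]
    exact tendsto_atBot_add_const_right _ _
      (tendsto_natCast_atTop_atTop.const_mul_atTop_of_neg hneg)

theorem image_sub_cone {C : Set V} (A : V ≃ₗ[ℝ] V) (hA : A '' C = C) (v : V) :
    (fun c => A v - c) '' C = A '' ((fun c => v - c) '' C) := by
  conv_lhs => rw [← hA]
  rw [image_image, image_image]
  simp

/-- Since `D` contains `-C`, the upper bound along its rays forces η ≥ 0 on `C`; on `D ∩ C` this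
leaves r‖v‖ ≤ M. -/
theorem CoercivelyBounded.isCompact_inter_cone [FiniteDimensional ℝ V] {C D : Set V}
    (hcoer : CoercivelyBounded D) (hD : IsClosed D) (hC : IsClosed C)
    (hneg : ∀ c ∈ C, ∀ t : ℝ, 0 ≤ t → -(t • c) ∈ D) : IsCompact (D ∩ C) := by
  obtain ⟨η, r, M, hr, hM⟩ := hcoer
  have hcone : ∀ v ∈ C, 0 ≤ inner ℝ η v := by
    intro v hv
    by_contra hlt
    have hpos : 0 < -inner ℝ η v := neg_pos.2 (not_le.1 hlt)
    have h0 := hM _ (hneg v hv 0 le_rfl)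
    simp only [zero_smul, neg_zero, inner_zero_right, norm_zero, mul_zero, add_zero] at h0
    set t : ℝ := (M + 1) / -inner ℝ η v with ht
    have h1 := hM _ (hneg v hv t (by positivity))
    have h2 : inner ℝ η (-(t • v)) = M + 1 := by
      rw [inner_neg_right, real_inner_smul_right, ← mul_neg, ht, div_mul_cancel₀ _ hpos.ne']
    have h3 : 0 ≤ r * ‖-(t • v)‖ := by positivity
    linarith
  have : ProperSpace V := FiniteDimensional.proper ℝ V
  refine Metric.isCompact_of_isClosed_isBounded (hD.inter hC) ?_
  refine (Metric.isBounded_closedBall (x := 0) (r := M / r)).subset ?_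
  rintro v ⟨hvD, hvC⟩
  rw [mem_closedBall_zero_iff, le_div_iff₀ hr]
  linarith [hM v hvD, hcone v hvC]

variable [MeasurableSpace V] (μ : Measure V)

/-- The characteristic function of the cone `C`: the integral over the dual cone of
`exp (-⟨ξ, v⟩)`. -/
noncomputable def coneLaplace (C : Set V) (v : V) : ℝ≥0∞ :=
  laplaceVolume μ ((fun c => v - c) '' C)

variable [BorelSpace V]

theorem coneLaplace_convex {C : Set V} (h0 : (0 : V) ∈ C)
    (hs : ∀ c ∈ C, ∀ t : ℝ, 0 ≤ t → t • c ∈ C) (v w : V) {a b : ℝ} (ha : 0 ≤ a) (hb : 0 ≤ b)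
    (hab : a + b = 1) :
    coneLaplace μ C (a • v + b • w) ≤
      ENNReal.ofReal a * coneLaplace μ C v + ENNReal.ofReal b * coneLaplace μ C w := by
  simp only [coneLaplace, laplaceVolume]
  rw [← lintegral_const_mul _ (measurable_laplaceWeight _),
    ← lintegral_const_mul _ (measurable_laplaceWeight _),
    ← lintegral_add_left ((measurable_laplaceWeight _).const_mul _)]
  refine lintegral_mono fun ξ => ?_
  simp only [laplaceWeight_sub_cone h0 hs]
  split_ifs
  · rw [← ENNReal.ofReal_mul ha, ← ENNReal.ofReal_mul hb,
      ← ENNReal.ofReal_add (by positivity) (by positivity)]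
    refine ENNReal.ofReal_le_ofReal ?_
    have := convexOn_exp.2 (mem_univ (-inner ℝ ξ v)) (mem_univ (-inner ℝ ξ w)) ha hb hab
    simp only [smul_eq_mul] at this
    refine le_trans (le_of_eq ?_) this
    rw [inner_add_right, inner_smul_right, inner_smul_right]
    congr 1; ring
  · simp

/-- Fatou's lemma, the integrand being continuous in v for fixed ξ. -/
theorem lowerSemicontinuous_coneLaplace {C : Set V} (h0 : (0 : V) ∈ C)
    (hs : ∀ c ∈ C, ∀ t : ℝ, 0 ≤ t → t • c ∈ C) : LowerSemicontinuous (coneLaplace μ C) := by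
  intro v y hy
  by_contra hcon
  have hfreq : ∃ᶠ w in 𝓝 v, coneLaplace μ C w ≤ y := by
    rw [not_eventually] at hcon
    exact hcon.mono fun w hw => not_lt.1 hw
  obtain ⟨u, hu, huy⟩ := exists_seq_forall_of_frequently hfreq
  refine hy.not_ge ?_
  have hlim : ∀ ξ, Tendsto (fun n => laplaceWeight ((fun c => u n - c) '' C) ξ) atTop
      (𝓝 (laplaceWeight ((fun c => v - c) '' C) ξ)) := by
    intro ξ
    simp only [laplaceWeight_sub_cone h0 hs]
    split_ifs
    · refine (ENNReal.continuous_ofReal.tendsto _).comp ((Real.continuous_exp.tendsto _).comp ?_)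
      exact (tendsto_const_nhds.inner hu).neg
    · exact tendsto_const_nhds
  calc coneLaplace μ C v
      = ∫⁻ ξ, liminf (fun n => laplaceWeight ((fun c => u n - c) '' C) ξ) atTop ∂μ :=
        lintegral_congr fun ξ => (hlim ξ).liminf_eq.symm
    _ ≤ liminf (fun n => coneLaplace μ C (u n)) atTop :=
        lintegral_liminf_le fun n => measurable_laplaceWeight _
    _ ≤ liminf (fun _ : ℕ => y) atTop := liminf_le_liminf (Eventually.of_forall huy)
    _ = y := liminf_const y

/-- Scaling by t preserves `C`, hence carries v - C to tv - C. -/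
theorem coneLaplace_smul [FiniteDimensional ℝ V] [μ.IsAddHaarMeasure] {C : Set V}
    (hs : ∀ c ∈ C, ∀ t : ℝ, 0 ≤ t → t • c ∈ C) {t : ℝ} (ht : 0 < t) (v : V) :
    coneLaplace μ C (t • v)
      = ENNReal.ofReal ((t ^ Module.finrank ℝ V)⁻¹) * coneLaplace μ C v := by
  rw [coneLaplace, coneLaplace, ← laplaceVolume_smul μ ht]
  congr 1
  refine image_sub_cone (LinearEquiv.smulOfNeZero ℝ V t ht.ne') (Subset.antisymm ?_ ?_) v
  · rintro _ ⟨c, hc, rfl⟩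
    exact hs c hc t ht.le
  · intro c hc
    exact ⟨t⁻¹ • c, hs c hc _ (inv_nonneg.2 ht.le), smul_inv_smul₀ ht.ne' c⟩

theorem coneLaplace_lt_top [FiniteDimensional ℝ V] [μ.IsAddHaarMeasure] {C : Set V} {v : V}
    (hv : v ∈ interior C) : coneLaplace μ C v < ∞ := by
  obtain ⟨r, hr, hball⟩ := Metric.nhds_basis_closedBall.mem_iff.1 (mem_interior_iff_mem_nhds.1 hv)
  refine laplaceVolume_lt_top μ hr fun w hw => ⟨v - w, hball ?_, sub_sub_cancel v w⟩
  simpa [Metric.mem_closedBall, dist_eq_norm] using hw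

/-- If the ratio of `min coneLaplace` to `laplaceVolume` does not increase when the convex set `D`
is moved towards the minimizer `v₀`, then `closure D` is star-shaped at infinity around `v₀`. -/
theorem expand_mem_closure_of_extremal [FiniteDimensional ℝ V] [μ.IsAddHaarMeasure]
    {C D : Set V} (h0 : (0 : V) ∈ C) (hs : ∀ c ∈ C, ∀ t : ℝ, 0 ≤ t → t • c ∈ C)
    (hadd : ∀ c ∈ C, ∀ c' ∈ C, c + c' ∈ C) (hconv : Convex ℝ D) (hcoer : CoercivelyBounded D)
    (hfin : laplaceVolume μ D ≠ ∞) {κ : ℝ≥0∞} (hκ0 : κ ≠ 0) (hκ : κ ≠ ∞) {v₀ : V} (hv₀C : v₀ ∈ C)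
    (hv₀ : v₀ ∈ closure D) (heq : coneLaplace μ C v₀ = κ * laplaceVolume μ D)
    (hmin : ∀ v ∈ closure D, v ∈ C → coneLaplace μ C v₀ ≤ coneLaplace μ C v)
    {t : ℝ} (ht : 0 < t) (ht1 : t < 1)
    (hopt : ∃ b ∈ C, (1 - t) • v₀ + b ∈ closure D ∧
      coneLaplace μ C b ≤ κ * laplaceVolume μ ((fun v => v - (1 - t) • v₀) '' D))
    {p : V} (hp : p ∈ closure D) : v₀ + t⁻¹ • (p - v₀) ∈ closure D := by
  set D₁ : Set V := (fun v => v - (1 - t) • v₀) '' D with hD₁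
  have hclD₁ : ∀ q, q ∈ closure D → q - (1 - t) • v₀ ∈ closure D₁ := fun q hq =>
    map_mem_closure (f := fun v => v - (1 - t) • v₀) (by fun_prop) hq
      fun v hv => mem_image_of_mem _ hv
  -- Convexity puts tv + (1-t)v₀ in `closure D`; subtract (1-t)v₀.
  have hsub : (fun v => t • v) '' D ⊆ closure D₁ := by
    rintro _ ⟨v, hv, rfl⟩
    have h1 := hconv.closure (subset_closure hv) hv₀ ht.le (sub_nonneg.2 ht1.le)
      (add_sub_cancel t 1)
    simpa using hclD₁ _ h1
  have hfin₁ : laplaceVolume μ (closure D₁) ≠ ∞ := by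
    refine ne_top_of_le_ne_top ?_ (laplaceVolume_anti μ hsub)
    rw [laplaceVolume_smul μ ht]
    exact ENNReal.mul_ne_top ENNReal.ofReal_ne_top hfin
  -- Otherwise φ(b) < φ(tv₀), so φ(t⁻¹b) < φ(v₀) by homogeneity. The point (1-t)v₀ + b is a convex
  -- combination of v₀ and t⁻¹b and an admissible apex, so convexity of φ contradicts minimality of
  -- v₀.
  have hle : laplaceVolume μ ((fun v => t • v) '' D) ≤ laplaceVolume μ (closure D₁) := by
    by_contra hlt
    rw [not_le, laplaceVolume_closure] at hlt
    obtain ⟨b, hbC, hbD, hb⟩ := hopt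
    have hb' : coneLaplace μ C b < coneLaplace μ C (t • v₀) := by
      refine hb.trans_lt ?_
      rw [coneLaplace_smul μ hs ht, heq, mul_left_comm, ← laplaceVolume_smul μ ht]
      exact ENNReal.mul_lt_mul_right hκ0 hκ hlt
    have hb'' : coneLaplace μ C (t⁻¹ • b) < coneLaplace μ C v₀ := by
      have hti : 0 < t⁻¹ := inv_pos.2 ht
      rw [coneLaplace_smul μ hs hti]
      conv_rhs => rw [← inv_smul_smul₀ ht.ne' v₀, coneLaplace_smul μ hs hti]
      refine ENNReal.mul_lt_mul_right ?_ ENNReal.ofReal_ne_top hb'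
      exact (ENNReal.ofReal_pos.2 (by positivity)).ne'
    have h1 := coneLaplace_convex μ h0 hs v₀ (t⁻¹ • b) (sub_nonneg.2 ht1.le) ht.le
      (sub_add_cancel 1 t)
    rw [smul_inv_smul₀ ht.ne'] at h1
    have h2 := (hmin _ hbD (hadd _ (hs _ hv₀C _ (sub_nonneg.2 ht1.le)) _ hbC)).trans h1
    have hfinv : coneLaplace μ C v₀ ≠ ∞ := by
      rw [heq]; exact ENNReal.mul_ne_top hκ hfin
    have h3 : ENNReal.ofReal (1 - t) * coneLaplace μ C v₀ +
        ENNReal.ofReal t * coneLaplace μ C (t⁻¹ • b) < coneLaplace μ C v₀ := by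
      calc _ < ENNReal.ofReal (1 - t) * coneLaplace μ C v₀ +
            ENNReal.ofReal t * coneLaplace μ C v₀ := by
            refine ENNReal.add_lt_add_left (ENNReal.mul_ne_top ENNReal.ofReal_ne_top hfinv) ?_
            exact ENNReal.mul_lt_mul_right (ENNReal.ofReal_pos.2 ht).ne'
              ENNReal.ofReal_ne_top hb''
        _ = coneLaplace μ C v₀ := by
            rw [← add_mul, ← ENNReal.ofReal_add (sub_nonneg.2 ht1.le) ht.le]; simp
    exact absurd h2 (not_le.2 h3)
  have hconvt : Convex ℝ ((fun v => t • v) '' D) := hconv.smul t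
  have hcl := subset_closure_of_laplaceVolume_le μ hconvt (hcoer.image_smul ht) hsub hfin₁ hle
  have h1 := hcl (hclD₁ p hp)
  have h2 : t⁻¹ • (p - (1 - t) • v₀) ∈ closure D := by
    refine map_mem_closure (f := fun v => t⁻¹ • v) (by fun_prop) h1 ?_
    rintro _ ⟨v, hv, rfl⟩
    simpa [inv_smul_smul₀ ht.ne'] using hv
  convert h2 using 1
  rw [show p - (1 - t) • v₀ = t • v₀ + (p - v₀) by module, smul_add, inv_smul_smul₀ ht.ne']

end ConeLaplace

/-! ### Asymptotic cones of properly convex domains -/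

section AsymptoticCone

variable {n : ℕ} {Ω : Set (EuclideanSpace ℝ (Fin n))}

theorem zero_mem_AC : (0 : EuclideanSpace ℝ (Fin n)) ∈ AC Ω := fun x hx t _ => by simpa using hx

theorem smul_mem_AC {u : EuclideanSpace ℝ (Fin n)} (hu : u ∈ AC Ω) {t : ℝ} (ht : 0 ≤ t) :
    t • u ∈ AC Ω := fun x hx τ hτ => by
  rw [smul_smul]; exact hu x hx _ (mul_nonneg hτ ht)

theorem add_mem_AC {u v : EuclideanSpace ℝ (Fin n)} (hu : u ∈ AC Ω) (hv : v ∈ AC Ω) :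
    u + v ∈ AC Ω := fun x hx t ht => by
  rw [smul_add, ← add_assoc]; exact hv _ (hu x hx t ht) t ht

theorem convex_AC : Convex ℝ (AC Ω) := fun _ hu _ hv _ _ ha hb _ =>
  add_mem_AC (smul_mem_AC hu ha) (smul_mem_AC hv hb)

/-- Segments from x to ever farther points of the ray at p have points converging to x + tu, which
is thus in the closure. The translate of the open set Ω by tu then lies in the interior of the
closure, which is Ω. -/
theorem mem_AC_of_closure (hΩ : IsOpen Ω) (hc : Convex ℝ Ω) {p u : EuclideanSpace ℝ (Fin n)}
    (h : ∀ t : ℝ, 0 ≤ t → p + t • u ∈ closure Ω) : u ∈ AC Ω := by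
  have hcl : ∀ x ∈ Ω, ∀ t : ℝ, 0 ≤ t → x + t • u ∈ closure Ω := by
    intro x hx t ht
    have hlim : Tendsto (fun ε : ℝ => x + t • u + ε • (p - x)) (𝓝[>] 0) (𝓝 (x + t • u)) := by
      have : Continuous (fun ε : ℝ => x + t • u + ε • (p - x)) := by fun_prop
      simpa using (this.tendsto 0).mono_left nhdsWithin_le_nhds
    refine isClosed_closure.mem_of_tendsto hlim ?_
    filter_upwards [Ioo_mem_nhdsGT (zero_lt_one' ℝ)] with ε hε
    have h1 := hc.closure (subset_closure hx) (h (t / ε) (div_nonneg ht hε.1.le))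
      (sub_nonneg.2 hε.2.le) hε.1.le (sub_add_cancel 1 ε)
    convert h1 using 1
    rw [smul_add, smul_smul, mul_div_cancel₀ _ hε.1.ne']
    module
  intro x hx t ht
  have hint : interior (closure Ω) = Ω := by
    rw [hc.interior_closure_eq_interior_of_nonempty_interior (by rw [hΩ.interior_eq]; exact ⟨x, hx⟩),
      hΩ.interior_eq]
  rw [← hint]
  refine interior_maximal (t := (fun y => y + t • u) '' Ω) ?_ ?_ ⟨x, hx, rfl⟩
  · rintro _ ⟨y, hy, rfl⟩
    exact hcl y hy t ht
  · exact (Homeomorph.addRight (t • u)).isOpenMap _ hΩ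

theorem isClosed_AC (hΩ : IsOpen Ω) (hc : Convex ℝ Ω) (hne : Ω.Nonempty) : IsClosed (AC Ω) := by
  obtain ⟨x, hx⟩ := hne
  refine isClosed_of_closure_subset fun u hu => mem_AC_of_closure hΩ hc (p := x) fun t ht => ?_
  exact map_mem_closure (f := fun u => x + t • u) (by fun_prop) hu fun v hv => hv x hx t ht

theorem eq_zero_of_neg_mem_AC (hp : IsProperlyConvex Ω) (hne : Ω.Nonempty)
    {u : EuclideanSpace ℝ (Fin n)} (hu : u ∈ AC Ω) (hu' : -u ∈ AC Ω) : u = 0 := by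
  obtain ⟨x, hx⟩ := hne
  refine hp.2 x u fun t => ?_
  rcases le_total 0 t with ht | ht
  · exact hu x hx t ht
  · simpa using hu' x hx (-t) (neg_nonneg.2 ht)

theorem exists_mem_dual_inner_pos (hΩ : IsOpen Ω) (hp : IsProperlyConvex Ω) (hne : Ω.Nonempty)
    {c : EuclideanSpace ℝ (Fin n)} (hc : c ∈ AC Ω) (hc0 : c ≠ 0) :
    ∃ η : EuclideanSpace ℝ (Fin n), (∀ u ∈ AC Ω, 0 ≤ inner ℝ η u) ∧ 0 < inner ℝ η c := by
  have hneg : -c ∉ AC Ω := fun h => hc0 (eq_zero_of_neg_mem_AC hp hne hc h)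
  obtain ⟨f, b, hb, hf⟩ :=
    geometric_hahn_banach_point_closed convex_AC (isClosed_AC hΩ hp.1 hne) hneg
  have hb0 : b < 0 := by simpa using hf 0 zero_mem_AC
  refine ⟨(InnerProductSpace.toDual ℝ _).symm f, fun u hu => ?_, ?_⟩
  · rw [InnerProductSpace.toDual_symm_apply]
    by_contra hlt
    rw [not_le] at hlt
    have h1 := hf _ (smul_mem_AC hu (div_nonneg_of_nonpos hb0.le hlt.le))
    rw [map_smul, smul_eq_mul, div_mul_cancel₀ _ hlt.ne] at h1
    exact lt_irrefl _ h1
  · rw [InnerProductSpace.toDual_symm_apply]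
    rw [map_neg] at hb
    linarith

/-- Compactness of the unit slice of the cone lets finitely many separating functionals be summed
into one that is positive on all of it. -/
theorem exists_inner_ge_norm_AC (hΩ : IsOpen Ω) (hp : IsProperlyConvex Ω) (hne : Ω.Nonempty) :
    ∃ (η : EuclideanSpace ℝ (Fin n)) (r : ℝ), 0 < r ∧ ∀ u ∈ AC Ω, r * ‖u‖ ≤ inner ℝ η u := by
  set S := AC Ω ∩ Metric.sphere 0 1 with hS
  have hScomp : IsCompact S := (isCompact_sphere _ _).inter_left (isClosed_AC hΩ hp.1 hne)
  obtain ⟨η, hη, hηS⟩ : ∃ η : EuclideanSpace ℝ (Fin n),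
      (∀ u ∈ AC Ω, 0 ≤ inner ℝ η u) ∧ ∀ u ∈ S, u ∈ AC Ω → 0 < inner ℝ η u := by
    refine hScomp.induction_on (p := fun s => ∃ η : EuclideanSpace ℝ (Fin n),
      (∀ u ∈ AC Ω, 0 ≤ inner ℝ η u) ∧ ∀ u ∈ s, u ∈ AC Ω → 0 < inner ℝ η u)
      ⟨0, by simp, by simp⟩ ?_ ?_ ?_
    · rintro s t hst ⟨η, h1, h2⟩
      exact ⟨η, h1, fun u hu => h2 u (hst hu)⟩
    · rintro s t ⟨η, h1, h2⟩ ⟨η', h1', h2'⟩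
      refine ⟨η + η', fun u hu => ?_, fun u hu hu' => ?_⟩
      · rw [inner_add_left]; exact add_nonneg (h1 u hu) (h1' u hu)
      · rw [inner_add_left]
        rcases hu with hu | hu
        · exact add_pos_of_pos_of_nonneg (h2 u hu hu') (h1' u hu')
        · exact add_pos_of_nonneg_of_pos (h1 u hu') (h2' u hu hu')
    · rintro c ⟨hc, hc1⟩
      obtain ⟨η, h1, h2⟩ := exists_mem_dual_inner_pos hΩ hp hne hc (by
        rintro rfl; simp at hc1)
      exact ⟨{u | 0 < inner ℝ η u}, mem_nhdsWithin_of_mem_nhds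
        ((isOpen_lt continuous_const (by fun_prop)).mem_nhds h2), η, h1, fun u hu _ => hu⟩
  obtain ⟨r, hr, hrS⟩ : ∃ r : ℝ, 0 < r ∧ ∀ u ∈ S, r ≤ inner ℝ η u := by
    rcases S.eq_empty_or_nonempty with h | h
    · exact ⟨1, one_pos, by simp [h]⟩
    · obtain ⟨c, hc, hmin⟩ := hScomp.exists_isMinOn h
        (f := fun u => inner ℝ η u) (by fun_prop)
      exact ⟨inner ℝ η c, hηS c hc hc.1, fun u hu => hmin hu⟩
  refine ⟨η, r, hr, fun u hu => ?_⟩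
  rcases eq_or_ne u 0 with rfl | hu0
  · simp
  · have hpos : 0 < ‖u‖ := norm_pos_iff.2 hu0
    have h1 := hrS (‖u‖⁻¹ • u) ⟨smul_mem_AC hu (inv_nonneg.2 hpos.le), by
      simp [norm_smul, hpos.ne']⟩
    rw [inner_smul_right, le_inv_mul_iff₀ hpos] at h1
    linarith

theorem exists_inner_ge_norm (hΩ : IsOpen Ω) (hp : IsProperlyConvex Ω) (hne : Ω.Nonempty) :
    ∃ (η : EuclideanSpace ℝ (Fin n)) (r M : ℝ), 0 < r ∧ ∀ p ∈ Ω, r * ‖p‖ - M ≤ inner ℝ η p := by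
  obtain ⟨η, r, hr, hη⟩ := exists_inner_ge_norm_AC hΩ hp hne
  obtain ⟨x, hx⟩ := hne
  -- Otherwise points escaping to infinity have a limiting unit direction u in the asymptotic cone
  -- with ⟨η, u⟩ ≤ r/2, contradicting ⟨η, u⟩ ≥ r.
  have key : ∃ k : ℕ, ∀ p ∈ Ω, (k : ℝ) ≤ ‖p - x‖ → r / 2 * ‖p - x‖ ≤ inner ℝ η (p - x) := by
    by_contra hcon
    push Not at hcon
    choose p hpΩ hpk hpη using hcon
    obtain ⟨u, -, φ, hφ, hu⟩ := (isCompact_closedBall (0 : EuclideanSpace ℝ (Fin n)) 1).tendsto_subseq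
      (x := fun k => ‖p k - x‖⁻¹ • (p k - x)) (fun k => by
        rw [mem_closedBall_zero_iff, norm_smul, norm_inv, norm_norm]
        exact inv_mul_le_one)
    have hpos : ∀ᶠ k in atTop, 0 < ‖p (φ k) - x‖ := by
      filter_upwards [eventually_ge_atTop 1] with k hk
      have h1 : (1 : ℝ) ≤ φ k := by exact_mod_cast hk.trans (hφ.id_le k)
      linarith [hpk (φ k)]
    have hnorm : ‖u‖ = 1 := by
      refine tendsto_nhds_unique hu.norm (tendsto_const_nhds.congr' ?_)
      filter_upwards [hpos] with k hk
      simp [norm_smul, hk.ne']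
    have huAC : u ∈ AC Ω := by
      refine mem_AC_of_closure hΩ hp.1 (p := x) fun t ht => ?_
      refine isClosed_closure.mem_of_tendsto ((hu.const_smul t).const_add x) ?_
      filter_upwards [hpos, eventually_ge_atTop ⌈t⌉₊] with k hk hkt
      have h1 : t ≤ ‖p (φ k) - x‖ :=
        (Nat.ceil_le.1 (hkt.trans (hφ.id_le k))).trans (hpk (φ k))
      refine subset_closure ?_
      have h2 := hp.1.add_smul_sub_mem hx (hpΩ (φ k)) (t := t * ‖p (φ k) - x‖⁻¹)
        ⟨by positivity, by rw [← div_eq_mul_inv]; exact (div_le_one hk).2 h1⟩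
      simpa [smul_smul] using h2
    have hle : inner ℝ η u ≤ r / 2 := by
      refine le_of_tendsto (tendsto_const_nhds.inner hu) ?_
      filter_upwards [hpos] with k hk
      simp only [Function.comp]
      rw [inner_smul_right, inv_mul_le_iff₀ hk, mul_comm]
      exact (hpη (φ k)).le
    have := hη u huAC
    rw [hnorm] at this
    linarith
  obtain ⟨k, hk⟩ := key
  refine ⟨η, r / 2, (r / 2 + ‖η‖) * k + (r / 2 + ‖η‖) * ‖x‖, half_pos hr, fun p hpΩ => ?_⟩
  have h1 : r / 2 * ‖p - x‖ - (r / 2 + ‖η‖) * k ≤ inner ℝ η (p - x) := by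
    rcases le_total (k : ℝ) ‖p - x‖ with h | h
    · have := hk p hpΩ h
      have : 0 ≤ (r / 2 + ‖η‖) * k := by positivity
      linarith
    · have h2 := neg_le_of_abs_le (abs_real_inner_le_norm η (p - x))
      have h3 : (r / 2 + ‖η‖) * ‖p - x‖ ≤ (r / 2 + ‖η‖) * k :=
        mul_le_mul_of_nonneg_left h (by positivity)
      linarith
  rw [inner_sub_right] at h1
  have h2 := neg_le_of_abs_le (abs_real_inner_le_norm η x)
  have h3 : r / 2 * ‖p‖ ≤ r / 2 * (‖p - x‖ + ‖x‖) :=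
    mul_le_mul_of_nonneg_left (by simpa using norm_add_le (p - x) x) (by positivity)
  linarith

end AsymptoticCone

/-! ### Sections of the domain and the action of its automorphisms -/

section Sections

variable {n : ℕ} {V : Type*} [NormedAddCommGroup V] [InnerProductSpace ℝ V]

/-- The asymptotic cone of `Ω`, seen in its linear span through the isometry `ι`. -/
def coneInSpan (ι : V →ₗᵢ[ℝ] EuclideanSpace ℝ (Fin n)) (Ω : Set (EuclideanSpace ℝ (Fin n))) :
    Set V :=
  ι ⁻¹' AC Ω

/-- The reflected section `x - Ω_x`, seen in the span of the asymptotic cone through the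
isometry `ι`. -/
def sectionDiff (ι : V →ₗᵢ[ℝ] EuclideanSpace ℝ (Fin n)) (Ω : Set (EuclideanSpace ℝ (Fin n)))
    (x : EuclideanSpace ℝ (Fin n)) : Set V :=
  {v | x - ι v ∈ Ω}

variable {ι : V →ₗᵢ[ℝ] EuclideanSpace ℝ (Fin n)} {Ω : Set (EuclideanSpace ℝ (Fin n))}

theorem zero_mem_coneInSpan : (0 : V) ∈ coneInSpan ι Ω := by
  rw [coneInSpan, mem_preimage, map_zero]
  exact zero_mem_AC

theorem smul_mem_coneInSpan : ∀ c ∈ coneInSpan ι Ω, ∀ t : ℝ, 0 ≤ t → t • c ∈ coneInSpan ι Ω := by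
  intro c hc t ht
  rw [coneInSpan, mem_preimage, map_smul]
  exact smul_mem_AC hc ht

theorem add_mem_coneInSpan :
    ∀ c ∈ coneInSpan ι Ω, ∀ c' ∈ coneInSpan ι Ω, c + c' ∈ coneInSpan ι Ω := by
  intro c hc c' hc'
  rw [coneInSpan, mem_preimage, map_add]
  exact add_mem_AC hc hc'

theorem convex_coneInSpan : Convex ℝ (coneInSpan ι Ω) :=
  convex_AC.linear_preimage ι.toLinearMap

theorem isClosed_coneInSpan (hΩ : IsOpen Ω) (hc : Convex ℝ Ω) (hne : Ω.Nonempty) :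
    IsClosed (coneInSpan ι Ω) :=
  (isClosed_AC hΩ hc hne).preimage ι.continuous

theorem image_coneInSpan (hι : LinearMap.range ι.toLinearMap = Submodule.span ℝ (AC Ω)) :
    ι '' coneInSpan ι Ω = AC Ω := by
  refine image_preimage_eq_of_subset fun u hu => ?_
  have h1 : u ∈ LinearMap.range ι.toLinearMap := hι ▸ Submodule.subset_span hu
  exact h1

theorem interior_coneInSpan_nonempty [FiniteDimensional ℝ V]
    (hι : LinearMap.range ι.toLinearMap = Submodule.span ℝ (AC Ω)) :
    (interior (coneInSpan ι Ω)).Nonempty := by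
  rw [convex_coneInSpan.interior_nonempty_iff_affineSpan_eq_top]
  have h : insert 0 (coneInSpan ι Ω) = coneInSpan ι Ω := insert_eq_of_mem zero_mem_coneInSpan
  have hspan : Submodule.span ℝ (coneInSpan ι Ω) = ⊤ := by
    refine Submodule.map_injective_of_injective (f := ι.toLinearMap) ι.injective ?_
    rw [Submodule.map_span, Submodule.map_top, hι]
    exact congrArg _ (image_coneInSpan hι)
  rw [← SetLike.coe_set_eq, ← h, affineSpan_insert_zero, hspan]
  rfl

theorem isOpen_sectionDiff (hΩ : IsOpen Ω) (x : EuclideanSpace ℝ (Fin n)) :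
    IsOpen (sectionDiff ι Ω x) :=
  hΩ.preimage (f := fun v : V => x - ι v)
    (by fun_prop)

theorem convex_sectionDiff (hc : Convex ℝ Ω) (x : EuclideanSpace ℝ (Fin n)) :
    Convex ℝ (sectionDiff ι Ω x) := by
  intro v hv w hw a b ha hb hab
  have h := hc hv hw ha hb hab
  have hx : x = a • x + b • x := by rw [← add_smul, hab, one_smul]
  change x - ι (a • v + b • w) ∈ Ω
  convert h using 1
  conv_lhs => rw [hx]
  simp only [map_add, map_smul]
  module

theorem zero_mem_sectionDiff {x : EuclideanSpace ℝ (Fin n)} (hx : x ∈ Ω) :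
    (0 : V) ∈ sectionDiff ι Ω x := by
  simpa [sectionDiff] using hx

theorem sub_mem_closure_of_mem_closure_sectionDiff {x : EuclideanSpace ℝ (Fin n)}
    {v : V} (hv : v ∈ closure (sectionDiff ι Ω x)) :
    x - ι v ∈ closure Ω :=
  map_mem_closure (f := fun v : V => x - ι v)
    (by fun_prop) hv fun _ h => h

theorem sub_cone_subset_closure_sectionDiff {x : EuclideanSpace ℝ (Fin n)}
    {v : V} (hv : v ∈ closure (sectionDiff ι Ω x)) :
    (fun c => v - c) '' coneInSpan ι Ω ⊆ closure (sectionDiff ι Ω x) := by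
  rintro _ ⟨c, hc, rfl⟩
  refine map_mem_closure (f := fun w => w - c) (by fun_prop) hv fun w hw => ?_
  have := hc _ hw 1 zero_le_one
  rw [one_smul] at this
  change x - ι (w - c) ∈ Ω
  convert this using 1
  simp only [map_sub]
  abel

theorem coercivelyBounded_sectionDiff [FiniteDimensional ℝ V] (hΩ : IsOpen Ω) (hp : IsProperlyConvex Ω)
    {x : EuclideanSpace ℝ (Fin n)} (hx : x ∈ Ω) : CoercivelyBounded (sectionDiff ι Ω x) := by
  obtain ⟨η, r, M, hr, h⟩ := exists_inner_ge_norm hΩ hp ⟨x, hx⟩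
  have : CompleteSpace V := FiniteDimensional.complete ℝ V
  refine ⟨ContinuousLinearMap.adjoint ι.toContinuousLinearMap η, r, M + r * ‖x‖ + ‖η‖ * ‖x‖, hr,
    fun v hv => ?_⟩
  have h1 := h _ hv
  rw [ContinuousLinearMap.adjoint_inner_left, LinearIsometry.coe_toContinuousLinearMap]
  rw [inner_sub_right] at h1
  have h2 : inner ℝ η x ≤ ‖η‖ * ‖x‖ := real_inner_le_norm η x
  have h3 : ‖v‖ ≤ ‖x - ι v‖ + ‖x‖ := by
    have := norm_sub_le x (x - ι v)
    rw [sub_sub_cancel] at this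
    rw [← ι.norm_map v]
    linarith
  have h4 := mul_le_mul_of_nonneg_left h3 hr.le
  linarith

/-- The section itself may be unbounded; requiring apexes to lie in the cone supplies the
compactness needed for a minimizer. -/
theorem isCompact_closure_sectionDiff_inter_cone [FiniteDimensional ℝ V]
    (hΩ : IsOpen Ω) (hp : IsProperlyConvex Ω)
    {x : EuclideanSpace ℝ (Fin n)} (hx : x ∈ Ω) :
    IsCompact (closure (sectionDiff ι Ω x) ∩ coneInSpan ι Ω) := by
  refine (coercivelyBounded_sectionDiff hΩ hp hx).closure.isCompact_inter_cone isClosed_closure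
    (isClosed_coneInSpan hΩ hp.1 ⟨x, hx⟩) fun c hc t ht => ?_
  have := sub_cone_subset_closure_sectionDiff (subset_closure (zero_mem_sectionDiff hx))
    ⟨_, smul_mem_coneInSpan c hc t ht, rfl⟩
  simpa using this

/-- If a ball around `x` lies in `Ω`, then sections through nearby points are almost contained in
the section through `x`. -/
theorem smul_mem_sectionDiff_of_near (hc : Convex ℝ Ω) {x y : EuclideanSpace ℝ (Fin n)} {r θ : ℝ}
    (hball : Metric.ball x r ⊆ Ω) (hθ : 0 < θ) (hθ1 : θ < 1) (hxy : dist x y < θ * r)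
    {v : V} (hv : v ∈ sectionDiff ι Ω y) :
    (1 - θ) • v ∈ sectionDiff ι Ω x := by
  -- This point is chosen so that, with weights θ and 1-θ, it and y - v average to x - (1-θ)v.
  have hz : x + (θ⁻¹ * (1 - θ)) • (x - y) ∈ Ω := by
    refine hball ?_
    rw [Metric.mem_ball, dist_eq_norm, add_sub_cancel_left, norm_smul, ← dist_eq_norm,
      Real.norm_of_nonneg (mul_nonneg (inv_nonneg.2 hθ.le) (sub_nonneg.2 hθ1.le)), mul_assoc,
      inv_mul_lt_iff₀ hθ]
    have := mul_nonneg hθ.le (dist_nonneg (x := x) (y := y))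
    linarith
  have h := hc hz hv hθ.le (sub_nonneg.2 hθ1.le) (add_sub_cancel θ 1)
  change x - ι ((1 - θ) • v) ∈ Ω
  convert h using 1
  rw [smul_add, smul_smul, mul_inv_cancel_left₀ hθ.ne']
  simp only [map_smul]
  module

theorem smul_mem_closure_sectionDiff_of_near (hc : Convex ℝ Ω) {x y : EuclideanSpace ℝ (Fin n)}
    {r θ : ℝ} (hball : Metric.ball x r ⊆ Ω) (hθ : 0 < θ) (hθ1 : θ < 1) (hxy : dist x y < θ * r)
    {v : V} (hv : v ∈ closure (sectionDiff ι Ω y)) :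
    (1 - θ) • v ∈ closure (sectionDiff ι Ω x) :=
  map_mem_closure (f := fun v => (1 - θ) • v) (by fun_prop) hv
    fun _ h => smul_mem_sectionDiff_of_near hc hball hθ hθ1 hxy h

theorem image_AC_of_mem_affineAut
    {g : EuclideanSpace ℝ (Fin n) ≃ᵃ[ℝ] EuclideanSpace ℝ (Fin n)} (hg : g ∈ affineAut Ω) :
    g.linear '' AC Ω = AC Ω := by
  have key : ∀ h ∈ affineAut Ω, ∀ u ∈ AC Ω,
      (h : EuclideanSpace ℝ (Fin n) ≃ᵃ[ℝ] EuclideanSpace ℝ (Fin n)).linear u ∈ AC Ω := by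
    intro h hh u hu x hx t ht
    have hh' : h '' Ω = Ω := hh
    rw [← hh'] at hx
    obtain ⟨y, hy, rfl⟩ := hx
    have h1 : h (y + t • u) ∈ h '' Ω := mem_image_of_mem h (hu y hy t ht)
    rw [hh'] at h1
    convert h1 using 1
    have := h.map_vadd y (t • u)
    rw [vadd_eq_add, vadd_eq_add, map_smul] at this
    rw [add_comm y, this, add_comm]
  refine Subset.antisymm ?_ fun u hu => ?_
  · rintro _ ⟨u, hu, rfl⟩
    exact key g hg u hu
  · refine ⟨_, key g⁻¹ (inv_mem hg) u hu, ?_⟩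
    exact g.linear.apply_symm_apply u

/-- An affine automorphism of `Ω` acts linearly on the span of the asymptotic cone, compatibly
with the cone and with the sections. -/
theorem exists_linearEquiv_span_of_mem_affineAut
    (hι : LinearMap.range ι.toLinearMap = Submodule.span ℝ (AC Ω))
    {g : EuclideanSpace ℝ (Fin n) ≃ᵃ[ℝ] EuclideanSpace ℝ (Fin n)} (hg : g ∈ affineAut Ω) :
    ∃ A : V ≃ₗ[ℝ] V, A '' coneInSpan ι Ω = coneInSpan ι Ω ∧
      ∀ x, sectionDiff ι Ω (g x) = A '' sectionDiff ι Ω x := by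
  have hAC := image_AC_of_mem_affineAut hg
  have hmap : (LinearMap.range ι.toLinearMap).map
      (g.linear : EuclideanSpace ℝ (Fin n) →ₗ[ℝ] EuclideanSpace ℝ (Fin n))
      = LinearMap.range ι.toLinearMap := by
    rw [hι, Submodule.map_span]
    exact congrArg _ hAC
  set e := LinearEquiv.ofInjective ι.toLinearMap ι.injective with he
  obtain ⟨A, hcoe⟩ : ∃ A : V ≃ₗ[ℝ] V, ∀ v, ι (A v) = g.linear (ι v) := by
    refine ⟨(e.trans (g.linear.ofSubmodules _ _ hmap)).trans e.symm, fun v => ?_⟩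
    have h1 : ∀ w, ι (e.symm w) = w := fun w => congrArg Subtype.val (e.apply_symm_apply w)
    exact h1 _
  refine ⟨A, ?_, fun x => ?_⟩
  · ext v
    obtain ⟨w, rfl⟩ := A.surjective v
    rw [A.injective.mem_set_image]
    change ι w ∈ AC Ω ↔ ι (A w) ∈ AC Ω
    rw [hcoe, ← g.linear.injective.mem_set_image (s := AC Ω), hAC]
  · ext v
    obtain ⟨w, rfl⟩ := A.surjective v
    rw [A.injective.mem_set_image]
    change g x - ι (A w) ∈ Ω ↔ x - ι w ∈ Ω
    have h1 : g x - g.linear (ι w) = g (x - ι w) := by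
      have := g.map_vadd x (-ι w)
      rw [vadd_eq_add, vadd_eq_add, map_neg] at this
      rw [sub_eq_add_neg x, add_comm x, this]
      abel
    have hg' : g '' Ω = Ω := hg
    have h2 := g.injective.mem_set_image (s := Ω) (a := x - ι w)
    rw [hg'] at h2
    rw [hcoe, h1, h2]

end Sections

/-! ### The extremal ratio between the best inscribed cone and the section -/

section Extremal

variable {n : ℕ} {V : Type*} [NormedAddCommGroup V] [InnerProductSpace ℝ V]
  [MeasurableSpace V]
  (ι : V →ₗᵢ[ℝ] EuclideanSpace ℝ (Fin n)) {Ω : Set (EuclideanSpace ℝ (Fin n))} (μ : Measure V)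

/-- The smallest Laplace volume of a translate of the asymptotic cone inside the section
through `x`. -/
noncomputable def minConeLaplace (Ω : Set (EuclideanSpace ℝ (Fin n))) (x : EuclideanSpace ℝ (Fin n)) : ℝ≥0∞ :=
  ⨅ v ∈ closure (sectionDiff ι Ω x) ∩ coneInSpan ι Ω, coneLaplace μ (coneInSpan ι Ω) v

theorem minConeLaplace_le {x : EuclideanSpace ℝ (Fin n)} {v : V}
    (hv : v ∈ closure (sectionDiff ι Ω x)) (hC : v ∈ coneInSpan ι Ω) :
    minConeLaplace ι μ Ω x ≤ coneLaplace μ (coneInSpan ι Ω) v :=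
  iInf₂_le v ⟨hv, hC⟩

variable [FiniteDimensional ℝ V] [BorelSpace V]

theorem exists_eq_minConeLaplace (hΩ : IsOpen Ω) (hp : IsProperlyConvex Ω)
    {x : EuclideanSpace ℝ (Fin n)} (hx : x ∈ Ω) :
    ∃ v ∈ closure (sectionDiff ι Ω x), v ∈ coneInSpan ι Ω ∧
      coneLaplace μ (coneInSpan ι Ω) v = minConeLaplace ι μ Ω x := by
  obtain ⟨v, hv, hmin⟩ := LowerSemicontinuousOn.exists_isMinOn
    (s := closure (sectionDiff ι Ω x) ∩ coneInSpan ι Ω) ⟨0, subset_closure (zero_mem_sectionDiff (ι := ι) hx), zero_mem_coneInSpan⟩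
    (isCompact_closure_sectionDiff_inter_cone hΩ hp hx)
    ((lowerSemicontinuous_coneLaplace μ zero_mem_coneInSpan smul_mem_coneInSpan
      ).lowerSemicontinuousOn _)
  exact ⟨v, hv.1, hv.2, le_antisymm (le_iInf₂ fun w hw => hmin hw) (minConeLaplace_le ι μ hv.1 hv.2)⟩

theorem laplaceVolume_sectionDiff_le (hΩ : IsOpen Ω) (hp : IsProperlyConvex Ω)
    {x : EuclideanSpace ℝ (Fin n)} (hx : x ∈ Ω) :
    laplaceVolume μ (sectionDiff ι Ω x) ≤ minConeLaplace ι μ Ω x := by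
  obtain ⟨v, hv, -, h⟩ := exists_eq_minConeLaplace ι μ hΩ hp hx
  rw [← h, ← laplaceVolume_closure]
  exact laplaceVolume_anti μ (sub_cone_subset_closure_sectionDiff hv)

variable [μ.IsAddHaarMeasure]

theorem laplaceVolume_sectionDiff_ne_top (hΩ : IsOpen Ω) {x : EuclideanSpace ℝ (Fin n)}
    (hx : x ∈ Ω) : laplaceVolume μ (sectionDiff ι Ω x) ≠ ∞ := by
  obtain ⟨r, hr, hball⟩ := Metric.nhds_basis_closedBall.mem_iff.1
    ((isOpen_sectionDiff (ι := ι) hΩ x).mem_nhds (zero_mem_sectionDiff (ι := ι) hx))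
  exact (laplaceVolume_lt_top μ hr hball).ne

/-- A small positive multiple of an interior point of the cone lies in the open section, and φ is
finite there. -/
theorem minConeLaplace_ne_top
    (hι : LinearMap.range ι.toLinearMap = Submodule.span ℝ (AC Ω))
    (hΩ : IsOpen Ω) {x : EuclideanSpace ℝ (Fin n)} (hx : x ∈ Ω) :
    minConeLaplace ι μ Ω x ≠ ∞ := by
  obtain ⟨c, hc⟩ := interior_coneInSpan_nonempty hι
  have hlim : Tendsto (fun t : ℝ => t • c) (𝓝[>] 0) (𝓝 0) := by
    have : Continuous (fun t : ℝ => t • c) := by fun_prop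
    simpa using (this.tendsto 0).mono_left nhdsWithin_le_nhds
  have hev := hlim.eventually ((isOpen_sectionDiff (ι := ι) hΩ x).mem_nhds (zero_mem_sectionDiff (ι := ι) hx))
  obtain ⟨t, ht, ht0⟩ := (hev.and self_mem_nhdsWithin).exists
  have ht0' : (0 : ℝ) < t := ht0
  refine ne_top_of_le_ne_top ?_ (minConeLaplace_le ι μ (subset_closure ht)
    (smul_mem_coneInSpan _ (interior_subset hc) _ ht0'.le))
  rw [coneLaplace_smul μ smul_mem_coneInSpan ht0']
  exact ENNReal.mul_ne_top ENNReal.ofReal_ne_top (coneLaplace_lt_top μ hc).ne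

/-- The induced linear map sends admissible apexes to admissible apexes and multiplies both volumes
by the same `k`. -/
theorem minConeLaplace_le_of_mem_affineAut
    (hι : LinearMap.range ι.toLinearMap = Submodule.span ℝ (AC Ω))
    (hΩ : IsOpen Ω) (hp : IsProperlyConvex Ω)
    {g : EuclideanSpace ℝ (Fin n) ≃ᵃ[ℝ] EuclideanSpace ℝ (Fin n)} (hg : g ∈ affineAut Ω)
    {κ : ℝ≥0∞} {x : EuclideanSpace ℝ (Fin n)} (hx : x ∈ Ω)
    (h : minConeLaplace ι μ Ω x ≤ κ * laplaceVolume μ (sectionDiff ι Ω x)) :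
    minConeLaplace ι μ Ω (g x) ≤ κ * laplaceVolume μ (sectionDiff ι Ω (g x)) := by
  obtain ⟨A, hAC, hAD⟩ := exists_linearEquiv_span_of_mem_affineAut hι hg
  obtain ⟨k, -, -, hk⟩ := exists_laplaceVolume_linearEquiv μ A
  obtain ⟨v, hv, hvC, hmin⟩ := exists_eq_minConeLaplace ι μ hΩ hp hx
  have hAv : A v ∈ closure (sectionDiff ι Ω (g x)) := by
    rw [hAD]
    exact map_mem_closure (f := A) A.toLinearMap.continuous_of_finiteDimensional hv
      fun w hw => mem_image_of_mem A hw
  calc minConeLaplace ι μ Ω (g x) ≤ coneLaplace μ (coneInSpan ι Ω) (A v) :=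
        minConeLaplace_le ι μ hAv (hAC ▸ mem_image_of_mem A hvC)
    _ = k * minConeLaplace ι μ Ω x := by
        rw [coneLaplace, image_sub_cone A hAC, hk, ← hmin, coneLaplace]
    _ ≤ k * (κ * laplaceVolume μ (sectionDiff ι Ω x)) := by gcongr
    _ = κ * laplaceVolume μ (sectionDiff ι Ω (g x)) := by rw [hAD, hk, mul_left_comm]

theorem laplaceVolume_le_of_near (hc : Convex ℝ Ω) {x y : EuclideanSpace ℝ (Fin n)} {r θ : ℝ}
    (hball : Metric.ball x r ⊆ Ω) (hθ : 0 < θ) (hθ1 : θ < 1) (hxy : dist x y < θ * r) :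
    laplaceVolume μ (sectionDiff ι Ω x) ≤
      ENNReal.ofReal (((1 - θ) ^ Module.finrank ℝ V)⁻¹) *
        laplaceVolume μ (sectionDiff ι Ω y) := by
  rw [← laplaceVolume_smul μ (sub_pos.2 hθ1)]
  refine laplaceVolume_anti μ ?_
  rintro _ ⟨v, hv, rfl⟩
  exact smul_mem_sectionDiff_of_near hc hball hθ hθ1 hxy hv

theorem minConeLaplace_le_of_near (hΩ : IsOpen Ω) (hp : IsProperlyConvex Ω)
    {x y : EuclideanSpace ℝ (Fin n)} (hy : y ∈ Ω) {r θ : ℝ}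
    (hball : Metric.ball x r ⊆ Ω) (hθ : 0 < θ) (hθ1 : θ < 1) (hxy : dist x y < θ * r) :
    minConeLaplace ι μ Ω x ≤
      ENNReal.ofReal (((1 - θ) ^ Module.finrank ℝ V)⁻¹) *
        minConeLaplace ι μ Ω y := by
  obtain ⟨v, hv, hvC, hmin⟩ := exists_eq_minConeLaplace ι μ hΩ hp hy
  rw [← hmin, ← coneLaplace_smul μ smul_mem_coneInSpan (sub_pos.2 hθ1)]
  exact minConeLaplace_le ι μ (smul_mem_closure_sectionDiff_of_near hp.1 hball hθ hθ1 hxy hv)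
    (smul_mem_coneInSpan _ hvC _ (sub_nonneg.2 hθ1.le))

/-- Moving the base point slightly costs a factor `k θ` in the numerator and another in the
denominator, and `k θ` tends to 1 as θ tends to 0. -/
theorem upperSemicontinuousAt_minConeLaplace_div (hΩ : IsOpen Ω) (hp : IsProperlyConvex Ω)
    {x : EuclideanSpace ℝ (Fin n)} (hx : x ∈ Ω) :
    UpperSemicontinuousAt
      (fun x => minConeLaplace ι μ Ω x / laplaceVolume μ (sectionDiff ι Ω x)) x := by
  intro b hb
  set R := minConeLaplace ι μ Ω x / laplaceVolume μ (sectionDiff ι Ω x) with hR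
  have hΦ0 := laplaceVolume_pos μ (coercivelyBounded_sectionDiff (ι := ι) hΩ hp hx)
  have hΦ := laplaceVolume_sectionDiff_ne_top ι μ hΩ hx
  set k : ℝ → ℝ≥0∞ := fun θ =>
    ENNReal.ofReal (((1 - θ) ^ Module.finrank ℝ V)⁻¹) with hk
  have hk1 : Tendsto k (𝓝[>] 0) (𝓝 1) := by
    have h1 : ContinuousAt (fun θ : ℝ =>
        ((1 - θ) ^ Module.finrank ℝ V)⁻¹) 0 :=
      ContinuousAt.inv₀ (by fun_prop) (by simp)
    have h2 := (ENNReal.continuous_ofReal.continuousAt.comp h1).tendsto.mono_left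
      (nhdsWithin_le_nhds (s := Ioi (0 : ℝ)))
    simpa [hk, Function.comp_def] using h2
  have hkR : Tendsto (fun θ => k θ * k θ * R) (𝓝[>] 0) (𝓝 R) := by
    have h1 := ENNReal.Tendsto.mul hk1 (Or.inl one_ne_zero) hk1 (Or.inl one_ne_zero)
    have h2 := ENNReal.Tendsto.mul_const (b := R) h1 (Or.inl (by simp))
    simpa using h2
  obtain ⟨θ, hθb, hθ⟩ := ((hkR.eventually_lt_const hb).and
    (Ioo_mem_nhdsGT (zero_lt_one' ℝ))).exists
  obtain ⟨r, hr, hball⟩ := Metric.isOpen_iff.1 hΩ x hx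
  filter_upwards [Metric.ball_mem_nhds x (mul_pos hθ.1 (half_pos hr))] with y hy
  rw [Metric.mem_ball] at hy
  have hyr : dist y x < r / 2 := hy.trans (by nlinarith [hθ.2])
  have hbally : Metric.ball y (r / 2) ⊆ Ω :=
    (Metric.ball_subset_ball' (by linarith)).trans hball
  have h1 := minConeLaplace_le_of_near ι μ hΩ hp hx hbally hθ.1 hθ.2 hy
  have h2 := laplaceVolume_le_of_near ι μ hp.1 hball hθ.1 hθ.2
    (y := y) (by rw [dist_comm]; nlinarith [hθ.1])
  refine lt_of_le_of_lt (ENNReal.div_le_of_le_mul ?_) hθb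
  calc minConeLaplace ι μ Ω y ≤ k θ * minConeLaplace ι μ Ω x := h1
    _ = k θ * (R * laplaceVolume μ (sectionDiff ι Ω x)) := by
        rw [hR, ENNReal.div_mul_cancel hΦ0 hΦ]
    _ ≤ k θ * (R * (k θ * laplaceVolume μ (sectionDiff ι Ω y))) := by gcongr
    _ = k θ * k θ * R * laplaceVolume μ (sectionDiff ι Ω y) := by ring

theorem exists_extremal_minConeLaplace
    (hι : LinearMap.range ι.toLinearMap = Submodule.span ℝ (AC Ω))
    (hp : IsProperlyConvex Ω) (hq : IsQuasiHomogeneous Ω)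
    (hne : Ω.Nonempty) :
    ∃ κ : ℝ≥0∞, ∃ y ∈ Ω, minConeLaplace ι μ Ω y = κ * laplaceVolume μ (sectionDiff ι Ω y) ∧
      ∀ x ∈ Ω, minConeLaplace ι μ Ω x ≤ κ * laplaceVolume μ (sectionDiff ι Ω x) := by
  obtain ⟨hΩ, G, hG, K, hK, hKΩ, hcover⟩ := hq
  have hKne : K.Nonempty := by
    obtain ⟨x, hx⟩ := hne
    rw [← hcover] at hx
    simp only [mem_iUnion] at hx
    obtain ⟨g, -, z, hz, -⟩ := hx
    exact ⟨z, hz⟩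
  obtain ⟨y, hy, hmax⟩ := UpperSemicontinuousOn.exists_isMaxOn hKne hK fun x hx =>
    (upperSemicontinuousAt_minConeLaplace_div ι μ hΩ hp (hKΩ hx)).upperSemicontinuousWithinAt K
  have hpos : ∀ z ∈ Ω, laplaceVolume μ (sectionDiff ι Ω z) ≠ 0 := fun z hz =>
    laplaceVolume_pos μ (coercivelyBounded_sectionDiff (ι := ι) hΩ hp hz)
  refine ⟨minConeLaplace ι μ Ω y / laplaceVolume μ (sectionDiff ι Ω y), y, hKΩ hy, ?_, fun x hx => ?_⟩
  · rw [ENNReal.div_mul_cancel (hpos y (hKΩ hy)) (laplaceVolume_sectionDiff_ne_top ι μ hΩ (hKΩ hy))]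
  · obtain ⟨g, hg, z, hz, rfl⟩ : ∃ g ∈ G, ∃ z ∈ K, g z = x := by
      have hx' := hx
      rw [← hcover] at hx'
      simpa only [mem_iUnion, mem_image, exists_prop] using hx'
    refine minConeLaplace_le_of_mem_affineAut ι μ hι hΩ hp (hG hg) (hKΩ hz) ?_
    rw [← ENNReal.div_le_iff (hpos z (hKΩ hz)) (laplaceVolume_sectionDiff_ne_top ι μ hΩ (hKΩ hz))]
    exact hmax hz

/-- The minimal Laplace volume of a translate of the asymptotic cone inside a section is the
Laplace volume of the section. -/
theorem minConeLaplace_le_laplaceVolume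
    (hι : LinearMap.range ι.toLinearMap = Submodule.span ℝ (AC Ω))
    (hp : IsProperlyConvex Ω) (hq : IsQuasiHomogeneous Ω)
    {x : EuclideanSpace ℝ (Fin n)} (hx : x ∈ Ω) :
    minConeLaplace ι μ Ω x ≤ laplaceVolume μ (sectionDiff ι Ω x) := by
  obtain ⟨κ, y, hy, hκy, hκ⟩ := exists_extremal_minConeLaplace ι μ hι hp hq ⟨x, hx⟩
  have hΩ := hq.1
  set D := sectionDiff ι Ω y with hD
  have hcoer := coercivelyBounded_sectionDiff (ι := ι) hΩ hp hy
  have hΦ0 : laplaceVolume μ D ≠ 0 := laplaceVolume_pos μ hcoer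
  have hΦ : laplaceVolume μ D ≠ ∞ := laplaceVolume_sectionDiff_ne_top ι μ hΩ hy
  have hκ0 : κ ≠ 0 := by
    rintro rfl
    have := laplaceVolume_sectionDiff_le ι μ hΩ hp hy
    rw [hκy, zero_mul] at this
    exact hΦ0 (le_antisymm this bot_le)
  have hκtop : κ ≠ ∞ := by
    rintro rfl
    rw [ENNReal.top_mul hΦ0] at hκy
    exact minConeLaplace_ne_top ι μ hι hΩ hy hκy
  obtain ⟨v₀, hv₀, hv₀C, hmin⟩ := exists_eq_minConeLaplace ι μ hΩ hp hy
  have hexp : ∀ t : ℝ, 0 < t → t < 1 → ∀ p ∈ closure D, v₀ + t⁻¹ • (p - v₀) ∈ closure D := by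
    intro t ht ht1 p hpD
    refine expand_mem_closure_of_extremal μ zero_mem_coneInSpan smul_mem_coneInSpan
      add_mem_coneInSpan (convex_sectionDiff hp.1 y) hcoer hΦ hκ0 hκtop hv₀C hv₀
      (hmin.trans hκy) (fun v hv hvC => hmin.trans_le (minConeLaplace_le ι μ hv hvC)) ht ht1 ?_ hpD
    set z : EuclideanSpace ℝ (Fin n) :=
      y - ι ((1 - t) • v₀) with hz
    have hzΩ : z ∈ Ω := by
      have h1 := hp.1.combo_interior_closure_mem_interior (hΩ.interior_eq.symm ▸ hy)
        (sub_mem_closure_of_mem_closure_sectionDiff hv₀) ht (sub_nonneg.2 ht1.le)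
        (add_sub_cancel t 1)
      rw [hΩ.interior_eq] at h1
      convert h1 using 1
      rw [hz]
      simp only [map_smul]
      module
    have hDz : sectionDiff ι Ω z = (fun v => v - (1 - t) • v₀) '' D := by
      ext w
      constructor
      · intro hw
        refine ⟨w + (1 - t) • v₀, ?_, add_sub_cancel_right _ _⟩
        have hw' : z - ι w ∈ Ω := hw
        change y - ι (w + (1 - t) • v₀) ∈ Ω
        convert hw' using 1
        rw [hz]
        simp only [map_add, map_smul]
        abel
      · rintro ⟨v, hv, rfl⟩
        have hv' : y - ι v ∈ Ω := hv
        change z - ι (v - (1 - t) • v₀) ∈ Ω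
        convert hv' using 1
        rw [hz]
        simp only [map_sub, map_smul]
        abel
    obtain ⟨b, hb, hbC, hbmin⟩ := exists_eq_minConeLaplace ι μ hΩ hp hzΩ
    refine ⟨b, hbC, ?_, ?_⟩
    · rw [hDz] at hb
      refine map_mem_closure (f := fun w => (1 - t) • v₀ + w) (by fun_prop) hb ?_
      rintro _ ⟨v, hv, rfl⟩
      simpa using hv
    · rw [← hDz, hbmin]
      exact hκ z hzΩ
  -- Convexity for τ ≤ 1 and expansion for τ > 1 put the whole ray from y - v₀ in direction v₀ - p
  -- into `closure Ω`.
  have hsub : closure D ⊆ (fun c => v₀ - c) '' coneInSpan ι Ω := by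
    intro p hpD
    refine ⟨v₀ - p, ?_, sub_sub_cancel v₀ p⟩
    refine mem_AC_of_closure hΩ hp.1 (p := y - ι v₀) fun τ hτ => ?_
    have h1 : v₀ + τ • (p - v₀) ∈ closure D := by
      rcases le_or_gt τ 1 with h | h
      · exact (convex_sectionDiff hp.1 y).closure.add_smul_sub_mem hv₀ hpD ⟨hτ, h⟩
      · simpa using hexp τ⁻¹ (inv_pos.2 (one_pos.trans h)) (inv_lt_one_of_one_lt₀ h) p hpD
    convert sub_mem_closure_of_mem_closure_sectionDiff h1 using 1
    simp only [map_add, map_sub, map_smul]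
    module
  -- The inclusion just shown gives κ Φ(D) = φ(v₀) ≤ Φ(D).
  have hκ1 : κ ≤ 1 := by
    have h1 : κ * laplaceVolume μ D ≤ 1 * laplaceVolume μ D := by
      rw [← hκy, ← hmin, one_mul, ← laplaceVolume_closure μ D]
      exact laplaceVolume_anti μ hsub
    exact (ENNReal.mul_le_mul_iff_left hΦ0 hΦ).1 h1
  calc minConeLaplace ι μ Ω x ≤ κ * laplaceVolume μ (sectionDiff ι Ω x) := hκ x hx
    _ ≤ 1 * laplaceVolume μ (sectionDiff ι Ω x) := by gcongr
    _ = _ := one_mul _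

end Extremal

/-! ### Sections are translated cones -/

section Foliation

variable {n : ℕ} {V : Type*} [NormedAddCommGroup V] [InnerProductSpace ℝ V]
  [FiniteDimensional ℝ V] {ι : V →ₗᵢ[ℝ] EuclideanSpace ℝ (Fin n)}
  {Ω : Set (EuclideanSpace ℝ (Fin n))}

/-- With ratio at most 1, the inscribed cone of least volume has no larger Laplace volume than the
section containing it, so the two closures coincide. -/
theorem exists_closure_sectionDiff_eq
    (hι : LinearMap.range ι.toLinearMap = Submodule.span ℝ (AC Ω)) (hp : IsProperlyConvex Ω)
    (hq : IsQuasiHomogeneous Ω) {x : EuclideanSpace ℝ (Fin n)} (hx : x ∈ Ω) :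
    ∃ v, closure (sectionDiff ι Ω x) = (fun c => v - c) '' coneInSpan ι Ω := by
  borelize V
  have hΩ := hq.1
  set μ : Measure V := Measure.addHaar
  obtain ⟨v, hv, -, hmin⟩ := exists_eq_minConeLaplace ι μ hΩ hp hx
  have hsub := sub_cone_subset_closure_sectionDiff hv
  refine ⟨v, Subset.antisymm ?_ hsub⟩
  have hclosed : IsClosed ((fun c => v - c) '' coneInSpan ι Ω) :=
    (Homeomorph.subLeft v).isClosedMap _ (isClosed_coneInSpan hΩ hp.1 ⟨x, hx⟩)
  have hconv : Convex ℝ ((fun c => v - c) '' coneInSpan ι Ω) := by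
    rintro _ ⟨c, hc, rfl⟩ _ ⟨c', hc', rfl⟩ a b ha hb hab
    refine ⟨a • c + b • c', convex_coneInSpan hc hc' ha hb hab, ?_⟩
    have hv1 : v = a • v + b • v := by rw [← add_smul, hab, one_smul]
    change v - (a • c + b • c') = a • (v - c) + b • (v - c')
    conv_lhs => rw [hv1]
    module
  rw [← hclosed.closure_eq]
  refine subset_closure_of_laplaceVolume_le μ hconv
    ((coercivelyBounded_sectionDiff hΩ hp hx).closure.mono hsub) hsub ?_ ?_
  · rw [laplaceVolume_closure]
    exact laplaceVolume_sectionDiff_ne_top ι μ hΩ hx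
  · rw [laplaceVolume_closure]
    exact hmin.le.trans (minConeLaplace_le_laplaceVolume ι μ hι hp hq hx)

/-- Seen in its span, the cone has full affine span, so its intrinsic and ordinary interiors agree;
an isometry transports the former. -/
theorem intrinsicInterior_AC (hι : LinearMap.range ι.toLinearMap = Submodule.span ℝ (AC Ω)) :
    intrinsicInterior ℝ (AC Ω) = ι '' interior (coneInSpan ι Ω) := by
  rw [← image_coneInSpan hι]
  refine (AffineIsometry.intrinsicInterior_image ι.toAffineIsometry _).trans ?_
  refine congrArg (ι '' ·) (Subset.antisymm ?_ interior_subset_intrinsicInterior)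
  have htop := convex_coneInSpan.interior_nonempty_iff_affineSpan_eq_top.1
    (interior_coneInSpan_nonempty hι)
  have hopen : IsOpen (affineSpan ℝ (coneInSpan ι Ω) : Set V) := by
    rw [htop]; exact isOpen_univ
  refine interior_maximal intrinsicInterior_subset ?_
  exact hopen.isOpenMap_subtype_val _ isOpen_interior

end Foliation

theorem theorem4p3 (n : ℕ) (Ω : Set (EuclideanSpace ℝ (Fin n)))
    (hconv : IsProperlyConvex Ω) (hqh : IsQuasiHomogeneous Ω) :
    ∀ x ∈ Ω, ∃ s : EuclideanSpace ℝ (Fin n),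
      asymptoticSection Ω x = (fun u => s + u) '' intrinsicInterior ℝ (AC Ω) ∧
      closure (asymptoticSection Ω x) = (fun u => s + u) '' AC Ω := by
  intro x hx
  set ι := (Submodule.span ℝ (AC Ω)).subtypeₗᵢ with hιdef
  have hι : LinearMap.range ι.toLinearMap = Submodule.span ℝ (AC Ω) := Submodule.range_subtype _
  obtain ⟨v, hv⟩ := exists_closure_sectionDiff_eq hι hconv hqh hx
  have hsec : asymptoticSection Ω x = (fun w => x - ι w) '' sectionDiff ι Ω x := by
    ext y
    constructor
    · rintro ⟨hy, hyx⟩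
      rw [SetLike.mem_coe, AffineSubspace.mem_mk', vsub_eq_sub] at hyx
      refine ⟨⟨x - y, by simpa using neg_mem hyx⟩, ?_, sub_sub_cancel x y⟩
      change x - (x - y) ∈ Ω
      rwa [sub_sub_cancel]
    · rintro ⟨w, hw, rfl⟩
      refine ⟨hw, ?_⟩
      rw [SetLike.mem_coe, AffineSubspace.mem_mk', vsub_eq_sub, sub_sub_cancel_left]
      exact neg_mem w.2
  -- An open convex set is the interior of its closure.
  have hint : sectionDiff ι Ω x = (fun c => v - c) '' interior (coneInSpan ι Ω) := by
    have hopen := isOpen_sectionDiff (ι := ι) hqh.1 x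
    have h1 := (convex_sectionDiff (ι := ι) hconv.1
      x).interior_closure_eq_interior_of_nonempty_interior
        (by rw [hopen.interior_eq]; exact ⟨0, zero_mem_sectionDiff hx⟩)
    rw [hopen.interior_eq, hv] at h1
    rw [← h1]
    exact ((Homeomorph.subLeft v).image_interior _).symm
  have htranslate : ∀ S : Set (Submodule.span ℝ (AC Ω)),
      (fun w => x - ι w) '' ((fun c => v - c) '' S) = (fun u => x - ι v + u) '' (ι '' S) := by
    intro S
    rw [image_image, image_image]
    refine image_congr fun c _ => ?_
    rw [map_sub]
    abel
  have hemb : IsClosedEmbedding (fun w => x - ι w) :=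
    (Homeomorph.subLeft x).isClosedEmbedding.comp
      (Submodule.closed_of_finiteDimensional _).isClosedEmbedding_subtypeVal
  -- Undoing the reflection w ↦ x - w turns the apex v of v - C into s = x - v.
  refine ⟨x - ι v, ?_, ?_⟩
  · rw [hsec, hint, htranslate, intrinsicInterior_AC hι]
  · rw [hsec, hemb.closure_image_eq, hv, htranslate, image_coneInSpan hι]
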